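/- Let $L^2[0,\infty)$ be the complex Hilbert space of square-integrable functions on the half-line. For a sequence $(c_n)_{n\ge1}$ of complex numbers with $\sum_{n\ge 1}|c_n|/\sqrt n<\infty$ let $T(c_n)$ be the bounded operator $T(c_n)f(x)=\sum_{n\ge1}c_nf(nx)$ on $L^2[0,\infty)$, let $Sf(x)=\frac1xf\left(\frac1x\right)$, and write $L(s;c_n)=\sum_{n\ge1}c_nn^{-s}$. Let $B$ be the unbounded operator $Bf(x)=i\left(xf'(x)+\tfrac12f(x)\right)$ on $L^2[0,\infty)$ whose domain consists of all $f\in L^2[0,\infty)\cap C^\infty(0,\infty)$ with $xf'+f/2\in L^2[0,\infty)$, and let $$\mathcal S_0=\Big\{f\in C^\infty(0,\infty):\ \sup_{x>0}x^n|f^{(k)}(x)|<\infty\ \text{ for all integers } k\ge0 \text{ and all } n\in\mathbb Z\Big\}\subset L^2[0,\infty).$$ Proposition. Let $(a_n)_{n\ge1}$ and $(b_n)_{n\ge1}$ be sequences of complex numbers that are inverse to each other for Dirichlet convolution, i.e. $\sum_{mk=n}a_mb_k$ equals $1$ for $n=1$ and $0$ for $n>1$. Assume that $\sum|a_n|n^{\epsilon}<\infty$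 for some $\epsilon>0$, that $\sum|b_n|/\sqrt n<\infty$, and that, for this $\epsilon$, there are constants $C_0,C_1\in\mathbb R$ and an integer $N\ge0$ with $$\left|\frac{L(1/2-y+ix;a_n)}{L(1/2+y+ix;a_n)}\right|\le C_0+C_1|x|^N$$ for all real $x,y$ with $|y|\le 1/2+\epsilon/2$ and $L(1/2+y+ix;a_n)\neq0$. Let $\mathcal F(a_n)=T(\overline{b_n})\,S\,T(a_n)$ be the Fourier-Poisson operator of $(a_n)$ on $L^2[0,\infty)$. Then for every $f\in\mathcal S_0$, both $f$ and $\mathcal F(a_n)f$ belong to the domain of $B$, and $$\mathcal F(a_n)Bf+B\mathcal F(a_n)f=0.$$ -/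

import Mathlib

open MeasureTheory Set
open scoped ContDiff

noncomputable section

namespace FourierPoisson

/-- Lebesgue measure on the half-line `(0, ∞)`. -/
abbrev halfLine : Measure ℝ := volume.restrict (Ioi (0 : ℝ))

/-- The complex Hilbert space `L²[0, ∞)`. -/
abbrev L2 : Type := Lp ℂ 2 halfLine

/-! ### Weighted composition operators on `L²[0, ∞)` -/

/-- Data making `f ↦ w · (f ∘ φ)` a contraction of `L²[0, ∞)`: `φ` is an injective differentiable
change of variables of the half-line and `|w|² ≤ |φ'|`. -/
structure Admissible (w : ℝ → ℂ) (φ φ' : ℝ → ℝ) : Prop where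
  meas_w : Measurable w
  meas_φ : Measurable φ
  maps : MapsTo φ (Ioi 0) (Ioi 0)
  inj : InjOn φ (Ioi 0)
  deriv : ∀ x ∈ Ioi (0 : ℝ), HasDerivWithinAt φ (φ' x) (Ioi 0) x
  deriv_ne : ∀ x ∈ Ioi (0 : ℝ), φ' x ≠ 0
  bound : ∀ x ∈ Ioi (0 : ℝ), ‖w x‖ ^ 2 ≤ |φ' x|

variable {w : ℝ → ℂ} {φ φ' : ℝ → ℝ}

theorem Admissible.lintegral_le (h : Admissible w φ φ') (g : ℝ → ENNReal) :
    ∫⁻ x in Ioi (0 : ℝ), ENNReal.ofReal |φ' x| * g (φ x) ≤ ∫⁻ x in Ioi (0 : ℝ), g x := by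
  rw [← lintegral_image_eq_lintegral_abs_deriv_mul measurableSet_Ioi h.deriv h.inj]
  exact lintegral_mono_set h.maps.image_subset

theorem Admissible.qmp (h : Admissible w φ φ') :
    Measure.QuasiMeasurePreserving φ halfLine halfLine := by
  refine ⟨h.meas_φ, Measure.AbsolutelyContinuous.mk fun s hs h0 => ?_⟩
  rw [Measure.map_apply h.meas_φ hs, Measure.restrict_apply (h.meas_φ hs)]
  have himg : volume (φ '' (φ ⁻¹' s ∩ Ioi 0)) = 0 := by
    rw [Measure.restrict_apply hs] at h0
    refine measure_mono_null ?_ h0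
    rintro _ ⟨x, ⟨hx, hx0⟩, rfl⟩
    exact ⟨hx, h.maps hx0⟩
  have hm : MeasurableSet (φ ⁻¹' s ∩ Ioi 0) := (h.meas_φ hs).inter measurableSet_Ioi
  have hd := lintegral_abs_det_fderiv_eq_addHaar_image volume hm
    (fun x hx => ((h.deriv x hx.2).mono inter_subset_right).hasFDerivWithinAt)
    (h.inj.mono inter_subset_right)
  rw [himg] at hd
  rw [lintegral_eq_zero_iff' (aemeasurable_ofReal_abs_det_fderivWithin volume hm
    (fun x hx => ((h.deriv x hx.2).mono inter_subset_right).hasFDerivWithinAt))] at hd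
  have hF : ∀ᵐ x ∂(volume.restrict (φ ⁻¹' s ∩ Ioi 0)), False := by
    filter_upwards [hd, ae_restrict_mem hm] with x hx hxm
    simp [h.deriv_ne x hxm.2] at hx
  simpa [ae_iff] using hF

theorem Admissible.eLpNorm_le (h : Admissible w φ φ') (f : ℝ → ℂ) :
    eLpNorm (fun x => w x * f (φ x)) 2 halfLine ≤ eLpNorm f 2 halfLine := by
  rw [eLpNorm_eq_lintegral_rpow_enorm_toReal two_ne_zero ENNReal.ofNat_ne_top,
    eLpNorm_eq_lintegral_rpow_enorm_toReal two_ne_zero ENNReal.ofNat_ne_top]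
  refine ENNReal.rpow_le_rpow ?_ (by positivity)
  refine le_trans ?_ (h.lintegral_le fun x => ‖f x‖ₑ ^ (ENNReal.toReal 2))
  refine setLIntegral_mono' measurableSet_Ioi fun x hx => ?_
  rw [enorm_mul, ENNReal.mul_rpow_of_nonneg _ _ (by positivity)]
  gcongr
  have := ENNReal.ofReal_le_ofReal (h.bound x hx)
  rw [ENNReal.ofReal_pow (norm_nonneg _), ofReal_norm] at this
  simpa using this

theorem Admissible.memLp (h : Admissible w φ φ') {f : ℝ → ℂ} (hf : MemLp f 2 halfLine) :
    MemLp (fun x => w x * f (φ x)) 2 halfLine :=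
  ⟨h.meas_w.aestronglyMeasurable.mul (hf.1.comp_quasiMeasurePreserving h.qmp),
    (h.eLpNorm_le f).trans_lt hf.2⟩

/-- The bounded operator `f ↦ w · (f ∘ φ)` on `L²[0, ∞)`. -/
def weightedComp (h : Admissible w φ φ') : L2 →L[ℂ] L2 :=
  LinearMap.mkContinuous
    { toFun := fun u => (h.memLp (Lp.memLp u)).toLp (fun x => w x * u (φ x))
      map_add' := fun u v => by
        rw [← MemLp.toLp_add]
        refine MemLp.toLp_congr _ _ ?_
        filter_upwards [h.qmp.ae_eq (Lp.coeFn_add u v)] with x hx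
        have hx' : (u + v : L2) (φ x) = u (φ x) + v (φ x) := hx
        change w x * (u + v : L2) (φ x) = w x * u (φ x) + w x * v (φ x)
        rw [hx', mul_add]
      map_smul' := fun c u => by
        rw [RingHom.id_apply, ← MemLp.toLp_const_smul]
        refine MemLp.toLp_congr _ _ ?_
        filter_upwards [h.qmp.ae_eq (Lp.coeFn_smul c u)] with x hx
        have hx' : (c • u : L2) (φ x) = c * u (φ x) := hx
        change w x * (c • u : L2) (φ x) = c * (w x * u (φ x))
        rw [hx', mul_left_comm] }
    1 fun u => by
      rw [one_mul]
      change ‖(h.memLp (Lp.memLp u)).toLp (fun x => w x * u (φ x))‖ ≤ ‖u‖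
      rw [Lp.norm_toLp, Lp.norm_def]
      exact ENNReal.toReal_mono (Lp.eLpNorm_ne_top u) (h.eLpNorm_le u)

theorem weightedComp_coeFn (h : Admissible w φ φ') (u : L2) :
    weightedComp h u =ᵐ[halfLine] fun x => w x * u (φ x) :=
  MemLp.coeFn_toLp (h.memLp (Lp.memLp u))

/-! ### The operators `T(c)`, `S` and `𝓕(a)` -/

theorem admissible_dilation (n : ℕ+) :
    Admissible (fun _ => 1) (fun x => (n : ℝ) * x) (fun _ => (n : ℝ)) where
  meas_w := by fun_prop
  meas_φ := by fun_prop
  maps := fun x hx => mem_Ioi.mpr (mul_pos (by exact_mod_cast n.pos) hx)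
  inj := fun x _ y _ hxy => by simpa using hxy
  deriv := fun x _ => by simpa using ((hasDerivAt_id x).const_mul (n : ℝ)).hasDerivWithinAt
  deriv_ne := fun x _ => by simp
  bound := fun x _ => by
    have : (1 : ℝ) ≤ (n : ℝ) := by exact_mod_cast (one_le : 1 ≤ n)
    simpa using this

theorem admissible_inversion :
    Admissible (fun x => (x : ℂ)⁻¹) (fun x => x⁻¹) (fun x => -(x ^ 2)⁻¹) where
  meas_w := by fun_prop
  meas_φ := by fun_prop
  maps := fun x hx => mem_Ioi.mpr (inv_pos.mpr hx)
  inj := fun x _ y _ hxy => inv_injective hxy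
  deriv := fun x hx => (hasDerivAt_inv (ne_of_gt hx)).hasDerivWithinAt
  deriv_ne := fun x hx => by
    have : x ≠ 0 := ne_of_gt hx
    simp [this]
  bound := fun x _ => by simp

/-- The dilation `f ↦ f(n ·)` on `L²[0, ∞)`. -/
def dilation (n : ℕ+) : L2 →L[ℂ] L2 := weightedComp (admissible_dilation n)

theorem dilation_coeFn (n : ℕ+) (u : L2) :
    dilation n u =ᵐ[halfLine] fun x => u ((n : ℝ) * x) := by
  have h := weightedComp_coeFn (admissible_dilation n) u
  simp only [one_mul] at h
  exact h

/-- The unitary involution `S f(x) = (1/x) f(1/x)` on `L²[0, ∞)`. -/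
def S : L2 →L[ℂ] L2 := weightedComp admissible_inversion

theorem S_coeFn (u : L2) : S u =ᵐ[halfLine] fun x => (x : ℂ)⁻¹ * u x⁻¹ :=
  weightedComp_coeFn admissible_inversion u

/-- The bounded operator `T(c) f(x) = ∑_{n ≥ 1} c_n f(n x)` on `L²[0, ∞)`. The dilation by `n` has
operator norm `n ^ (-1/2)`, so the series converges absolutely in operator norm
when `∑ |c_n| / √n < ∞`. -/
def T (c : ℕ → ℂ) : L2 →L[ℂ] L2 := ∑' n : ℕ+, c n • dilation n

/-- The Fourier-Poisson operator `𝓕(a) = T(conj b) S T(a)` of a sequence `a`,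
where `b` is the inverse of `a` for Dirichlet convolution. -/
def fourierPoisson (a b : ArithmeticFunction ℂ) : L2 →L[ℂ] L2 :=
  T (fun n => starRingEnd ℂ (b n)) ∘L S ∘L T (fun n => a n)

/-! ### The operator `B` and the class `𝓢₀` -/

/-- The expression `i (x f'(x) + f(x) / 2)`. -/
def eulerExpr (f : ℝ → ℂ) (x : ℝ) : ℂ := Complex.I * ((x : ℂ) * deriv f x + f x / 2)

/-- `f` is a smooth function on `(0, ∞)` representing `u ∈ L²`, with `x f' + f / 2 ∈ L²`. -/
structure IsDomRep (u : L2) (f : ℝ → ℂ) : Prop where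
  smooth : ContDiffOn ℝ ∞ f (Ioi 0)
  rep : u =ᵐ[halfLine] f
  memLp : MemLp (eulerExpr f) 2 halfLine

theorem IsDomRep.deriv_eq {u v : L2} {f g : ℝ → ℂ} (hf : IsDomRep u f) (hg : IsDomRep v g)
    (huv : u = v) : eulerExpr f =ᵐ[halfLine] eulerExpr g := by
  subst huv
  have hEq : EqOn f g (Ioi 0) := Measure.eqOn_open_of_ae_eq (hf.rep.symm.trans hg.rep) isOpen_Ioi
    hf.smooth.continuousOn hg.smooth.continuousOn
  filter_upwards [ae_restrict_mem measurableSet_Ioi] with x hx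
  simp only [eulerExpr, hEq hx, (hEq.eventuallyEq_of_mem (isOpen_Ioi.mem_nhds hx)).deriv_eq]

theorem eulerExpr_add {f g : ℝ → ℂ} (hf : ContDiffOn ℝ ∞ f (Ioi 0))
    (hg : ContDiffOn ℝ ∞ g (Ioi 0)) :
    eulerExpr (f + g) =ᵐ[halfLine] eulerExpr f + eulerExpr g := by
  filter_upwards [ae_restrict_mem measurableSet_Ioi] with x hx
  have hx' := isOpen_Ioi.mem_nhds hx
  have h1 := (hf.contDiffAt hx').differentiableAt (by simp)
  have h2 := (hg.contDiffAt hx').differentiableAt (by simp)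
  simp only [eulerExpr, Pi.add_apply, deriv_add h1 h2]
  ring

theorem eulerExpr_smul (c : ℂ) {f : ℝ → ℂ} (hf : ContDiffOn ℝ ∞ f (Ioi 0)) :
    eulerExpr (c • f) =ᵐ[halfLine] c • eulerExpr f := by
  filter_upwards [ae_restrict_mem measurableSet_Ioi] with x hx
  have h1 := (hf.contDiffAt (isOpen_Ioi.mem_nhds hx)).differentiableAt (by simp)
  simp only [eulerExpr, Pi.smul_apply, deriv_const_smul c h1, smul_eq_mul]
  ring

theorem IsDomRep.add {u v : L2} {f g : ℝ → ℂ} (hf : IsDomRep u f) (hg : IsDomRep v g) :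
    IsDomRep (u + v) (f + g) where
  smooth := hf.smooth.add hg.smooth
  rep := (Lp.coeFn_add u v).trans (hf.rep.add hg.rep)
  memLp := (hf.memLp.add hg.memLp).ae_eq (eulerExpr_add hf.smooth hg.smooth).symm

theorem IsDomRep.smul (c : ℂ) {u : L2} {f : ℝ → ℂ} (hf : IsDomRep u f) :
    IsDomRep (c • u) (c • f) where
  smooth := contDiffOn_const.smul hf.smooth
  rep := (Lp.coeFn_smul c u).trans (hf.rep.const_smul c)
  memLp := (hf.memLp.const_smul c).ae_eq (eulerExpr_smul c hf.smooth).symm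

theorem IsDomRep.zero : IsDomRep 0 0 where
  smooth := contDiffOn_const
  rep := Lp.coeFn_zero ..
  memLp := by
    have : eulerExpr 0 = 0 := by
      funext x
      simp [eulerExpr]
    rw [this]
    exact MemLp.zero

/-- The domain of `B`: the `f ∈ L²[0, ∞)` that are smooth on `(0, ∞)`
with `x f' + f / 2 ∈ L²[0, ∞)`. -/
def domB : Submodule ℂ L2 where
  carrier := {u | ∃ f : ℝ → ℂ, IsDomRep u f}
  zero_mem' := ⟨0, IsDomRep.zero⟩
  add_mem' := fun ⟨f, hf⟩ ⟨g, hg⟩ => ⟨f + g, hf.add hg⟩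
  smul_mem' := fun c _ ⟨f, hf⟩ => ⟨c • f, hf.smul c⟩

/-- The unbounded operator `B f = i (x f' + f / 2)` on `L²[0, ∞)` with domain `domB`. The smooth
representative chosen here is unique on `(0, ∞)`. -/
def B : L2 →ₗ.[ℂ] L2 where
  domain := domB
  toFun :=
    { toFun := fun u => u.2.choose_spec.memLp.toLp (eulerExpr u.2.choose)
      map_add' := fun u v => by
        have hu := u.2.choose_spec
        have hv := v.2.choose_spec
        rw [← MemLp.toLp_add]
        exact MemLp.toLp_congr _ _ (((u + v).2.choose_spec.deriv_eq (hu.add hv) rfl).trans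
          (eulerExpr_add hu.smooth hv.smooth))
      map_smul' := fun c u => by
        have hu := u.2.choose_spec
        rw [RingHom.id_apply, ← MemLp.toLp_const_smul]
        exact MemLp.toLp_congr _ _ (((c • u).2.choose_spec.deriv_eq (hu.smul c) rfl).trans
          (eulerExpr_smul c hu.smooth)) }

/-- `B` is computed by any smooth representative. -/
theorem B_coeFn {u : B.domain} {f : ℝ → ℂ} (hf : IsDomRep (u : L2) f) :
    B u =ᵐ[halfLine] fun x => Complex.I * ((x : ℂ) * deriv f x + f x / 2) :=
  have h : ∃ g : ℝ → ℂ, IsDomRep (u : L2) g := u.2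
  (MemLp.coeFn_toLp h.choose_spec.memLp).trans (h.choose_spec.deriv_eq hf rfl)

/-- The class `𝓢₀` of `f ∈ L²[0, ∞)` that are smooth on `(0, ∞)` with
`sup_{x > 0} x ^ n |f⁽ᵏ⁾(x)| < ∞` for all `k ≥ 0` and all integers `n`, negative ones included. -/
def S0 : Set L2 :=
  {u | ∃ f : ℝ → ℂ, u =ᵐ[halfLine] f ∧ ContDiffOn ℝ ∞ f (Ioi 0) ∧
    ∀ (k : ℕ) (n : ℤ), ∃ C : ℝ, ∀ x : ℝ, 0 < x → x ^ n * ‖iteratedDeriv k f x‖ ≤ C}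

end FourierPoisson

end

open Filter
open scoped Topology

noncomputable section

namespace FourierPoisson

/-! ### Logarithmic coordinates -/

/-! Writing f(x) = x^(-1/2) φ(log x) identifies L²(0, ∞) with L²(ℝ). There `B` becomes i d/dt, the
dilation by n becomes n^(-1/2) times translation by log n, and `S` becomes the reflection t ↦ -t.
Differentiation commutes with translations, hence with every `T c`, and anticommutes with the
reflection. Since `fourierPoisson a b` contains exactly one `S`, it anticommutes with `B`.

What remains is analytic. For f in `S0` the function φ is smooth with all derivatives bounded, so
the series for `T c` converges uniformly together with all its derivatives, and this class is
preserved (`SmoothBounded.logT`, `deriv_logT`). `T_ofLog` matches the pointwise series with the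
operator-norm series. The image of f is thus represented by a smooth ψ whose derivative represents
-𝓕(a)v, where v ∈ L² is represented by φ' (`exists_fourierPoisson_ofLog`). As 𝓕(a) is bounded on L²,
ψ' is automatically square-integrable, which puts 𝓕(a)f in the domain of `B`. -/

/-- The function on `(0, ∞)` given by `φ` in logarithmic coordinates, normalized so that
`φ ↦ ofLog φ` is an isometry from `L²(ℝ)` to `L²(0, ∞)`. -/
def ofLog (φ : ℝ → ℂ) (x : ℝ) : ℂ := (√x : ℂ)⁻¹ * φ (Real.log x)

/-- `φ` is smooth and all its derivatives are bounded. -/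
structure SmoothBounded (φ : ℝ → ℂ) : Prop where
  smooth : ContDiff ℝ ∞ φ
  bound : ∀ k : ℕ, ∃ C : ℝ, ∀ t, ‖iteratedDeriv k φ t‖ ≤ C

theorem SmoothBounded.deriv {φ : ℝ → ℂ} (h : SmoothBounded φ) : SmoothBounded (deriv φ) where
  smooth := (contDiff_infty_iff_deriv.mp h.smooth).2
  bound k := by
    simp only [← iteratedDeriv_succ']
    exact h.bound (k + 1)

theorem SmoothBounded.comp_neg {φ : ℝ → ℂ} (h : SmoothBounded φ) :
    SmoothBounded (fun t => φ (-t)) where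
  smooth := h.smooth.comp contDiff_neg
  bound k := by
    obtain ⟨C, hC⟩ := h.bound k
    refine ⟨C, fun t => ?_⟩
    rw [iteratedDeriv_comp_neg, norm_smul]
    simpa using hC (-t)

/-- The term -1/2 comes from differentiating x^(-1/2); the summand f/2 in `B` cancels it. -/
theorem hasDerivAt_ofLog {φ : ℝ → ℂ} {x : ℝ} (hx : 0 < x)
    (hφ : DifferentiableAt ℝ φ (Real.log x)) :
    HasDerivAt (ofLog φ) ((x : ℂ)⁻¹ * (ofLog (deriv φ) x - ofLog φ x / 2)) x := by
  have hs : √x ≠ 0 := (Real.sqrt_pos.mpr hx).ne'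
  have h1 : HasDerivAt (fun y : ℝ => ((√y : ℝ) : ℂ)⁻¹)
      (((-(1 / (2 * √x)) / √x ^ 2 : ℝ)) : ℂ) x := by
    simpa using ((Real.hasDerivAt_sqrt hx.ne').fun_inv hs).ofReal_comp
  have h2 : HasDerivAt (fun y => φ (Real.log y)) (x⁻¹ • deriv φ (Real.log x)) x :=
    hφ.hasDerivAt.scomp x (Real.hasDerivAt_log hx.ne')
  refine (h1.mul h2).congr_deriv ?_
  have hs' : (√x : ℂ) ≠ 0 := by exact_mod_cast hs
  have hx' : (x : ℂ) = (√x : ℂ) ^ 2 := by exact_mod_cast (Real.sq_sqrt hx.le).symm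
  simp only [ofLog, Complex.real_smul]
  push_cast
  rw [hx']
  field_simp
  ring

theorem contDiffOn_ofLog {φ : ℝ → ℂ} (hφ : ContDiff ℝ ∞ φ) : ContDiffOn ℝ ∞ (ofLog φ) (Ioi 0) := by
  intro x hx
  have hx' : x ≠ 0 := ne_of_gt hx
  have hs : (√x : ℂ) ≠ 0 := by exact_mod_cast (Real.sqrt_pos.mpr hx).ne'
  refine ContDiffAt.contDiffWithinAt (ContDiffAt.mul (ContDiffAt.inv ?_ hs) ?_)
  · exact Complex.ofRealCLM.contDiff.contDiffAt.comp x (Real.contDiffAt_sqrt hx')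
  · exact hφ.contDiffAt.comp x (Real.contDiffAt_log.mpr hx')

theorem eulerExpr_ofLog {φ : ℝ → ℂ} (hφ : Differentiable ℝ φ) {x : ℝ} (hx : 0 < x) :
    eulerExpr (ofLog φ) x = Complex.I * ofLog (deriv φ) x := by
  have hx' : (x : ℂ) ≠ 0 := by exact_mod_cast hx.ne'
  rw [eulerExpr, (hasDerivAt_ofLog hx (hφ _)).deriv]
  field_simp
  ring

theorem eulerExpr_ofLog_ae {v : L2} {φ : ℝ → ℂ} (hφ : ContDiff ℝ ∞ φ)
    (hv : v =ᵐ[halfLine] ofLog (deriv φ)) :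
    eulerExpr (ofLog φ) =ᵐ[halfLine] (Complex.I • v : L2) := by
  filter_upwards [ae_restrict_mem measurableSet_Ioi, hv, Lp.coeFn_smul Complex.I v] with x hx h1 h2
  rw [eulerExpr_ofLog (hφ.differentiable (by simp)) hx, h2, Pi.smul_apply, h1, smul_eq_mul]

/-- The element v serves as a certificate that the derivative is square-integrable, so no estimate
is needed here. -/
theorem isDomRep_ofLog {u v : L2} {φ : ℝ → ℂ} (hφ : ContDiff ℝ ∞ φ) (hu : u =ᵐ[halfLine] ofLog φ)
    (hv : v =ᵐ[halfLine] ofLog (deriv φ)) : IsDomRep u (ofLog φ) where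
  smooth := contDiffOn_ofLog hφ
  rep := hu
  memLp := (Lp.memLp (Complex.I • v)).ae_eq (eulerExpr_ofLog_ae hφ hv).symm

/-- In logarithmic coordinates `B` is `i d/dt`. -/
theorem exists_B_eq {u v : L2} {φ : ℝ → ℂ} (hφ : ContDiff ℝ ∞ φ) (hu : u =ᵐ[halfLine] ofLog φ)
    (hv : v =ᵐ[halfLine] ofLog (deriv φ)) :
    ∃ h : u ∈ B.domain, B ⟨u, h⟩ = Complex.I • v := by
  have hr := isDomRep_ofLog hφ hu hv
  have h : u ∈ B.domain := ⟨_, hr⟩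
  refine ⟨h, Lp.ext ?_⟩
  exact (B_coeFn (u := ⟨u, h⟩) hr).trans (eulerExpr_ofLog_ae hφ hv)

/-! ### `S` and the dilations in logarithmic coordinates -/

theorem S_ofLog {u : L2} {φ : ℝ → ℂ} (hu : u =ᵐ[halfLine] ofLog φ) :
    S u =ᵐ[halfLine] ofLog (fun t => φ (-t)) := by
  filter_upwards [ae_restrict_mem measurableSet_Ioi, S_coeFn u,
    admissible_inversion.qmp.ae_eq hu] with x hx h1 h2
  have h2' : u x⁻¹ = ofLog φ x⁻¹ := h2
  have hs : (√x : ℂ) ≠ 0 := by exact_mod_cast (Real.sqrt_pos.mpr hx).ne'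
  have hx' : (x : ℂ) = (√x : ℂ) ^ 2 := by exact_mod_cast (Real.sq_sqrt (le_of_lt hx)).symm
  rw [h1, h2']
  simp only [ofLog, Real.log_inv, Real.sqrt_inv]
  rw [hx']
  push_cast
  field_simp

theorem dilation_ofLog (n : ℕ+) {u : L2} {φ : ℝ → ℂ} (hu : u =ᵐ[halfLine] ofLog φ) :
    dilation n u =ᵐ[halfLine]
      ofLog (fun t => (√(n : ℝ) : ℂ)⁻¹ * φ (t + Real.log n)) := by
  filter_upwards [ae_restrict_mem measurableSet_Ioi, dilation_coeFn n u,
    (admissible_dilation n).qmp.ae_eq hu] with x hx h1 h2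
  have h2' : u ((n : ℝ) * x) = ofLog φ ((n : ℝ) * x) := h2
  have hn : (n : ℝ) ≠ 0 := by exact_mod_cast n.ne_zero
  rw [h1, h2']
  simp only [ofLog]
  rw [Real.log_mul hn (ne_of_gt hx), Real.sqrt_mul (by positivity), add_comm]
  push_cast
  rw [mul_inv]
  ring

/-- The weight √n turns the contraction bound into an equality; dividing by it gives the norm bound
n^(-1/2) for `dilation n`. -/
theorem admissible_normalized_dilation (n : ℕ+) :
    Admissible (fun _ => (√(n : ℝ) : ℂ)) (fun x => (n : ℝ) * x) (fun _ => (n : ℝ)) where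
  __ := admissible_dilation n
  meas_w := measurable_const
  bound _ _ := by simp

theorem norm_dilation_le (n : ℕ+) : ‖dilation n‖ ≤ (√(n : ℝ))⁻¹ := by
  have hs : √(n : ℝ) ≠ 0 := by simp
  have hs' : (√(n : ℝ) : ℂ) ≠ 0 := by exact_mod_cast hs
  have h : dilation n = (√(n : ℝ) : ℂ)⁻¹ • weightedComp (admissible_normalized_dilation n) := by
    ext1 u
    refine Lp.ext ?_
    filter_upwards [dilation_coeFn n u, weightedComp_coeFn (admissible_normalized_dilation n) u,
      Lp.coeFn_smul (√(n : ℝ) : ℂ)⁻¹ (weightedComp (admissible_normalized_dilation n) u)]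
      with x h1 h2 h3
    rw [h1, smul_apply, h3, Pi.smul_apply, h2, smul_eq_mul,
      inv_mul_cancel_left₀ hs']
  rw [h, norm_smul, norm_inv, Complex.norm_real, Real.norm_of_nonneg (Real.sqrt_nonneg _)]
  exact mul_le_of_le_one_right (by positivity) (LinearMap.mkContinuous_norm_le _ zero_le_one _)

/-! ### The operators `T(c)` in logarithmic coordinates -/

/-- The operator `T(c)` in logarithmic coordinates. -/
def logT (c : ℕ → ℂ) (φ : ℝ → ℂ) (t : ℝ) : ℂ :=
  ∑' n : ℕ+, c n * ((√(n : ℝ) : ℂ)⁻¹ * φ (t + Real.log n))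

section

variable {c : ℕ → ℂ} {φ : ℝ → ℂ}

theorem summable_pnat (hc : Summable fun n : ℕ => ‖c n‖ / √(n : ℝ)) :
    Summable fun n : ℕ+ => ‖c n‖ / √((n : ℕ) : ℝ) :=
  hc.comp_injective (i := ((↑) : ℕ+ → ℕ)) PNat.coe_injective

theorem norm_term_le {C : ℝ} (hC : ∀ t, ‖φ t‖ ≤ C) (n : ℕ+) (t : ℝ) :
    ‖c n * ((√(n : ℝ) : ℂ)⁻¹ * φ (t + Real.log n))‖ ≤ ‖c n‖ / √((n : ℕ) : ℝ) * C := by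
  rw [norm_mul, norm_mul, norm_inv, Complex.norm_real, Real.norm_of_nonneg (Real.sqrt_nonneg _),
    div_eq_mul_inv, mul_assoc]
  gcongr
  exact hC _

theorem summable_smul_dilation (hc : Summable fun n : ℕ => ‖c n‖ / √(n : ℝ)) :
    Summable fun n : ℕ+ => c n • dilation n := by
  refine Summable.of_norm_bounded (summable_pnat hc) fun n => ?_
  rw [norm_smul, div_eq_mul_inv]
  gcongr
  exact norm_dilation_le n

/-- The partial sums converge in L², hence almost everywhere along a sequence of finite sets
exhausting `ℕ+`. Boundedness of φ makes the pointwise series absolutely convergent, so its sum is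
the limit along that same sequence. -/
theorem T_ofLog (hc : Summable fun n : ℕ => ‖c n‖ / √(n : ℝ)) {C : ℝ} (hC : ∀ t, ‖φ t‖ ≤ C)
    {u : L2} (hu : u =ᵐ[halfLine] ofLog φ) : T c u =ᵐ[halfLine] ofLog (logT c φ) := by
  have hL : Tendsto (fun s : Finset ℕ+ => ∑ n ∈ s, c n • dilation n u) atTop (𝓝 (T c u)) := by
    have := (ContinuousLinearMap.apply ℂ L2 u).hasSum (summable_smul_dilation hc).hasSum
    simpa [HasSum, T] using this
  obtain ⟨ns, hns, hae⟩ :=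
    (tendstoInMeasure_of_tendsto_Lp hL).exists_seq_tendsto_ae'
  have hsum (s : Finset ℕ+) : (∑ n ∈ s, c n • dilation n u : L2) =ᵐ[halfLine]
      fun x => ∑ n ∈ s, c n * (dilation n u) x := by
    refine (Lp.coeFn_fun_finsetSum s _).trans ?_
    have : ∀ᵐ x ∂halfLine, ∀ n : ℕ+, (c n • dilation n u : L2) x = c n * (dilation n u) x := by
      rw [ae_all_iff]
      exact fun n => Lp.coeFn_smul _ _
    filter_upwards [this] with x hx
    exact Finset.sum_congr rfl fun n _ => hx n
  have hd : ∀ᵐ x ∂halfLine, ∀ n : ℕ+, dilation n u x =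
      ofLog (fun t => (√(n : ℝ) : ℂ)⁻¹ * φ (t + Real.log n)) x := by
    rw [ae_all_iff]
    exact fun n => dilation_ofLog n hu
  filter_upwards [hae, ae_all_iff.mpr fun k => hsum (ns k), hd] with x h1 h2 h3
  refine tendsto_nhds_unique h1 ?_
  have hs : Summable fun n : ℕ+ => c n * ((√(n : ℝ) : ℂ)⁻¹ * φ (Real.log x + Real.log n)) :=
    Summable.of_norm_bounded ((summable_pnat hc).mul_right C) fun n => norm_term_le hC n _
  refine ((hs.hasSum.mul_left (√x : ℂ)⁻¹).comp hns).congr fun k => ?_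
  rw [h2 k]
  refine Finset.sum_congr rfl fun n _ => ?_
  rw [h3 n]
  simp only [ofLog]
  ring

theorem iteratedDeriv_term (hφ : ContDiff ℝ ∞ φ) (k n : ℕ) (z : ℂ) :
    iteratedDeriv k (fun t => z * ((√(n : ℝ) : ℂ)⁻¹ * φ (t + Real.log n))) =
      fun t => z * ((√(n : ℝ) : ℂ)⁻¹ * iteratedDeriv k φ (t + Real.log n)) := by
  have h := hφ.of_le (m := k) (by exact_mod_cast le_top)
  have h' : ContDiff ℝ k fun t => φ (t + Real.log n) := h.comp (contDiff_id.add contDiff_const)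
  funext t
  rw [iteratedDeriv_const_mul_field, iteratedDeriv_const_mul_field, iteratedDeriv_comp_add_const]

theorem contDiff_term (hφ : ContDiff ℝ ∞ φ) (n : ℕ) (z : ℂ) :
    ContDiff ℝ ∞ (fun t => z * ((√(n : ℝ) : ℂ)⁻¹ * φ (t + Real.log n))) :=
  contDiff_const.mul (contDiff_const.mul (hφ.comp (contDiff_id.add contDiff_const)))

/-- Termwise differentiation is justified by the majorant sup|φ'| · |c n| / √n. -/
theorem deriv_logT (hc : Summable fun n : ℕ => ‖c n‖ / √(n : ℝ)) (hφ : SmoothBounded φ) :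
    deriv (logT c φ) = logT c (deriv φ) := by
  obtain ⟨C, hC⟩ := hφ.bound 0
  obtain ⟨D, hD⟩ := hφ.bound 1
  simp only [iteratedDeriv_zero, iteratedDeriv_one] at hC hD
  have hder (n : ℕ+) (t : ℝ) : HasDerivAt
      (fun t => c n * ((√(n : ℝ) : ℂ)⁻¹ * φ (t + Real.log n)))
      (c n * ((√(n : ℝ) : ℂ)⁻¹ * deriv φ (t + Real.log n))) t :=
    ((((hφ.smooth.differentiable (by simp)) _).hasDerivAt.comp_add_const t _).const_mul _).const_mul _
  funext t
  exact (hasDerivAt_tsum ((summable_pnat hc).mul_right D) hder (fun n t => norm_term_le hD n t)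
    (y₀ := 0) (Summable.of_norm_bounded ((summable_pnat hc).mul_right C)
      fun n => norm_term_le hC n _) t).deriv

theorem norm_logT_le (hc : Summable fun n : ℕ => ‖c n‖ / √(n : ℝ)) {C : ℝ} (hC : ∀ t, ‖φ t‖ ≤ C)
    (t : ℝ) : ‖logT c φ t‖ ≤ (∑' n : ℕ+, ‖c n‖ / √((n : ℕ) : ℝ)) * C :=
  tsum_of_norm_bounded ((summable_pnat hc).hasSum.mul_right C) fun n => norm_term_le hC n t

theorem iteratedDeriv_logT (hc : Summable fun n : ℕ => ‖c n‖ / √(n : ℝ)) (hφ : SmoothBounded φ)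
    (k : ℕ) : iteratedDeriv k (logT c φ) = logT c (iteratedDeriv k φ) := by
  induction k generalizing φ with
  | zero => simp
  | succ k ih => rw [iteratedDeriv_succ', deriv_logT hc hφ, ih hφ.deriv, iteratedDeriv_succ']

theorem SmoothBounded.logT (hc : Summable fun n : ℕ => ‖c n‖ / √(n : ℝ)) (hφ : SmoothBounded φ) :
    SmoothBounded (logT c φ) where
  smooth := by
    choose C hC using hφ.bound
    refine contDiff_tsum (v := fun k (n : ℕ+) => ‖c n‖ / √((n : ℕ) : ℝ) * C k)
      (fun n => contDiff_term hφ.smooth n _) (fun k _ => (summable_pnat hc).mul_right _)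
      fun k n t _ => ?_
    rw [norm_iteratedFDeriv_eq_norm_iteratedDeriv, iteratedDeriv_term hφ.smooth]
    exact norm_term_le (hC k) n t
  bound k := by
    obtain ⟨C, hC⟩ := hφ.bound k
    rw [iteratedDeriv_logT hc hφ]
    exact ⟨_, norm_logT_le hc hC⟩

end

/-! ### The Fourier-Poisson operator in logarithmic coordinates -/

theorem exists_fourierPoisson_ofLog {a b : ArithmeticFunction ℂ}
    (ha : Summable fun n : ℕ => ‖a n‖ / √(n : ℝ)) (hb : Summable fun n : ℕ => ‖b n‖ / √(n : ℝ))
    {u v : L2} {φ : ℝ → ℂ} (hφ : SmoothBounded φ) (hu : u =ᵐ[halfLine] ofLog φ)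
    (hv : v =ᵐ[halfLine] ofLog (deriv φ)) :
    ∃ ψ : ℝ → ℂ, ContDiff ℝ ∞ ψ ∧ fourierPoisson a b u =ᵐ[halfLine] ofLog ψ ∧
      (-fourierPoisson a b v : L2) =ᵐ[halfLine] ofLog (deriv ψ) := by
  have hb' : Summable fun n : ℕ => ‖starRingEnd ℂ (b n)‖ / √(n : ℝ) := by simpa using hb
  have hrep {w : L2} {χ : ℝ → ℂ} (hχ : SmoothBounded χ) (hw : w =ᵐ[halfLine] ofLog χ) :
      fourierPoisson a b w =ᵐ[halfLine] ofLog (logT (fun n => starRingEnd ℂ (b n))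
        (fun t => logT (fun n => a n) χ (-t))) := by
    obtain ⟨C, hC⟩ := hχ.bound 0
    obtain ⟨D, hD⟩ := (hχ.logT ha).comp_neg.bound 0
    rw [iteratedDeriv_zero] at hC hD
    exact T_ofLog hb' hD (S_ofLog (T_ofLog ha hC hw))
  have hsb := (hφ.logT ha).comp_neg
  refine ⟨_, (hsb.logT hb').smooth, hrep hφ hu, ?_⟩
  filter_upwards [Lp.coeFn_neg (fourierPoisson a b v), hrep hφ.deriv hv] with x h1 h2
  -- The reflection is the only source of the sign.
  have hneg : deriv (fun t => logT (fun n => a n) φ (-t)) =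
      fun t => -logT (fun n => a n) (deriv φ) (-t) := by
    funext t
    rw [deriv_comp_neg, deriv_logT ha hφ]
  rw [h1, Pi.neg_apply, h2, deriv_logT hb' hsb, hneg]
  simp [ofLog, logT, tsum_neg]

/-! ### The class `𝓢₀` in logarithmic coordinates -/

section

variable {f : ℝ → ℂ}

theorem contDiffOn_iteratedDeriv (hf : ContDiffOn ℝ ∞ f (Ioi 0)) (k : ℕ) :
    ContDiffOn ℝ ∞ (iteratedDeriv k f) (Ioi 0) := by
  induction k with
  | zero => simpa using hf
  | succ k ih =>
    rw [iteratedDeriv_succ]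
    exact ((contDiffOn_infty_iff_deriv_of_isOpen isOpen_Ioi).mp ih).2

/-- The function `t ↦ x ^ α f⁽ᵏ⁾(x)` of `t = log x`. -/
def expDeriv (f : ℝ → ℂ) (α : ℝ) (k : ℕ) (t : ℝ) : ℂ :=
  (Real.exp (α * t) : ℂ) * iteratedDeriv k f (Real.exp t)

theorem contDiff_expDeriv (hf : ContDiffOn ℝ ∞ f (Ioi 0)) (α : ℝ) (k : ℕ) :
    ContDiff ℝ ∞ (expDeriv f α k) := by
  refine ContDiff.mul ?_ ?_
  · exact Complex.ofRealCLM.contDiff.comp (Real.contDiff_exp.comp (contDiff_const.mul contDiff_id))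
  · exact contDiff_iff_contDiffAt.mpr fun t => ((contDiffOn_iteratedDeriv hf k).contDiffAt
      (isOpen_Ioi.mem_nhds (Real.exp_pos t))).comp t Real.contDiff_exp.contDiffAt

/-- The family `expDeriv f α k` is closed under differentiation up to linear combinations, so
bounding every member bounds all derivatives of each. -/
theorem deriv_expDeriv (hf : ContDiffOn ℝ ∞ f (Ioi 0)) (α : ℝ) (k : ℕ) :
    deriv (expDeriv f α k) =
      (fun t => (α : ℂ) * expDeriv f α k t) + expDeriv f (α + 1) (k + 1) := by
  funext t
  have h1 : HasDerivAt (fun t : ℝ => (Real.exp (α * t) : ℂ))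
      ((Real.exp (α * t) * α : ℝ) : ℂ) t := by
    have := ((hasDerivAt_id t).const_mul α).exp
    simpa using this.ofReal_comp
  have h2 : HasDerivAt (iteratedDeriv k f) (iteratedDeriv (k + 1) f (Real.exp t)) (Real.exp t) := by
    rw [iteratedDeriv_succ]
    exact (((contDiffOn_iteratedDeriv hf k).contDiffAt
      (isOpen_Ioi.mem_nhds (Real.exp_pos t))).differentiableAt (by simp)).hasDerivAt
  refine ((h1.mul (h2.scomp t (Real.hasDerivAt_exp t))).congr_deriv ?_).deriv
  simp only [Pi.add_apply, expDeriv, add_mul, Real.exp_add, one_mul, Complex.real_smul,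
    Function.comp_apply]
  push_cast
  ring

/-- The class `S0` controls integer powers only, while α = 1/2 is needed: x^α is at most x^⌊α⌋ +
x^⌈α⌉, the first term dominating for x ≤ 1 and the second for x ≥ 1. -/
theorem exists_norm_expDeriv_le
    (hb : ∀ (k : ℕ) (n : ℤ), ∃ C : ℝ, ∀ x : ℝ, 0 < x → x ^ n * ‖iteratedDeriv k f x‖ ≤ C)
    (α : ℝ) (k : ℕ) : ∃ C, ∀ t, ‖expDeriv f α k t‖ ≤ C := by
  obtain ⟨C, hC⟩ := hb k ⌊α⌋
  obtain ⟨D, hD⟩ := hb k ⌈α⌉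
  refine ⟨C + D, fun t => ?_⟩
  refine le_trans ?_ (add_le_add (hC _ (Real.exp_pos t)) (hD _ (Real.exp_pos t)))
  rw [expDeriv, norm_mul, Complex.norm_real, Real.norm_of_nonneg (Real.exp_pos _).le, ← add_mul]
  have hpow (n : ℤ) : Real.exp t ^ n = Real.exp (n * t) := by
    rw [← Real.rpow_intCast, ← Real.exp_mul, mul_comm]
  rw [hpow, hpow]
  gcongr
  rcases le_total 0 t with ht | ht
  · have : Real.exp (α * t) ≤ Real.exp (⌈α⌉ * t) :=
      Real.exp_le_exp.mpr (mul_le_mul_of_nonneg_right (Int.le_ceil α) ht)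
    linarith [Real.exp_pos (⌊α⌋ * t)]
  · have : Real.exp (α * t) ≤ Real.exp (⌊α⌋ * t) :=
      Real.exp_le_exp.mpr (mul_le_mul_of_nonpos_right (Int.floor_le α) ht)
    linarith [Real.exp_pos (⌈α⌉ * t)]

theorem smoothBounded_expDeriv (hf : ContDiffOn ℝ ∞ f (Ioi 0))
    (hb : ∀ (k : ℕ) (n : ℤ), ∃ C : ℝ, ∀ x : ℝ, 0 < x → x ^ n * ‖iteratedDeriv k f x‖ ≤ C)
    (α : ℝ) (k : ℕ) : SmoothBounded (expDeriv f α k) where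
  smooth := contDiff_expDeriv hf α k
  bound m := by
    induction m generalizing α k with
    | zero => simpa using exists_norm_expDeriv_le hb α k
    | succ m ih =>
      obtain ⟨C, hC⟩ := ih α k
      obtain ⟨D, hD⟩ := ih (α + 1) (k + 1)
      refine ⟨|α| * C + D, fun t => ?_⟩
      have h (β : ℝ) (j : ℕ) : ContDiff ℝ m (expDeriv f β j) :=
        (contDiff_expDeriv hf β j).of_le (by exact_mod_cast le_top)
      rw [iteratedDeriv_succ', deriv_expDeriv hf,
        iteratedDeriv_add (contDiff_const.mul (h α k)).contDiffAt (h _ _).contDiffAt,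
        iteratedDeriv_const_mul_field]
      refine (norm_add_le _ _).trans (add_le_add ?_ (hD t))
      rw [norm_mul, Complex.norm_real, Real.norm_eq_abs]
      gcongr
      exact hC t

theorem ofLog_expDeriv (α : ℝ) (k : ℕ) {x : ℝ} (hx : 0 < x) :
    ofLog (expDeriv f (α + 1 / 2) k) x = ((x ^ α : ℝ) : ℂ) * iteratedDeriv k f x := by
  have hs : (√x : ℂ) ≠ 0 := by exact_mod_cast (Real.sqrt_pos.mpr hx).ne'
  have h : Real.exp ((α + 1 / 2) * Real.log x) = x ^ α * √x := by
    rw [mul_comm, ← Real.rpow_def_of_pos hx, Real.rpow_add hx, Real.sqrt_eq_rpow]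
  rw [ofLog, expDeriv, h, Real.exp_log hx]
  push_cast
  field_simp

theorem memLp_mul_deriv (hf : ContDiffOn ℝ ∞ f (Ioi 0))
    (hb : ∀ (k : ℕ) (n : ℤ), ∃ C : ℝ, ∀ x : ℝ, 0 < x → x ^ n * ‖iteratedDeriv k f x‖ ≤ C) :
    MemLp (fun x : ℝ => (x : ℂ) * deriv f x) 2 halfLine := by
  -- Bounds on x|f'| and x³|f'| add up to (1 + x²) · x|f'| ≤ C + D, and (1 + x²)⁻¹ is in L².
  obtain ⟨C, hC⟩ := hb 1 1
  obtain ⟨D, hD⟩ := hb 1 3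
  have hmeas : AEStronglyMeasurable (fun x : ℝ => (x : ℂ) * deriv f x) halfLine := by
    refine ContinuousOn.aestronglyMeasurable ?_ measurableSet_Ioi
    have := (contDiffOn_iteratedDeriv hf 1).continuousOn
    rw [iteratedDeriv_one] at this
    exact Complex.continuous_ofReal.continuousOn.mul this
  have hdom : MemLp (fun x : ℝ => (1 + x ^ 2)⁻¹) 2 halfLine := by
    rw [memLp_two_iff_integrable_sq (by fun_prop)]
    refine (integrable_inv_one_add_sq.mono' (by fun_prop) (ae_of_all _ fun x => ?_)).restrict
    have h1 : (1 + x ^ 2)⁻¹ ≤ 1 := inv_le_one_of_one_le₀ (by nlinarith [sq_nonneg x])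
    have h0 : 0 ≤ (1 + x ^ 2)⁻¹ := by positivity
    rw [Real.norm_of_nonneg (by positivity)]
    nlinarith
  refine (hdom.const_mul (C + D)).mono' hmeas ?_
  filter_upwards [ae_restrict_mem measurableSet_Ioi] with x hx
  have hx' : 0 < x := hx
  have h1 := hC x hx
  have h2 := hD x hx
  rw [iteratedDeriv_one] at h1 h2
  rw [norm_mul, Complex.norm_real, Real.norm_of_nonneg hx'.le, ← div_eq_mul_inv,
    le_div_iff₀ (by positivity)]
  norm_cast at h1 h2
  nlinarith

end

/-- An element of `𝓢₀` is smooth with bounded derivatives in logarithmic coordinates, and the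
derivative there is represented in `L²`. -/
theorem exists_ofLog_of_mem_S0 {u : L2} (hu : u ∈ S0) :
    ∃ (φ : ℝ → ℂ) (v : L2), SmoothBounded φ ∧ u =ᵐ[halfLine] ofLog φ ∧
      v =ᵐ[halfLine] ofLog (deriv φ) := by
  obtain ⟨f, hrep, hf, hb⟩ := hu
  have hf0 {x : ℝ} (hx : 0 < x) : ofLog (expDeriv f (1 / 2) 0) x = f x := by
    simpa using ofLog_expDeriv (f := f) 0 0 hx
  have hf1 {x : ℝ} (hx : 0 < x) : ofLog (expDeriv f (1 / 2 + 1) 1) x = x * deriv f x := by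
    rw [add_comm]
    simpa using ofLog_expDeriv (f := f) 1 1 hx
  -- For φ(t) = e^(t/2) f(e^t), the derivative φ' corresponds to f/2 + x f' on the half-line.
  have hmem : MemLp (fun x : ℝ => (1 / 2 : ℂ) * u x + x * deriv f x) 2 halfLine :=
    ((Lp.memLp u).const_mul _).add (memLp_mul_deriv hf hb)
  refine ⟨expDeriv f (1 / 2) 0, hmem.toLp _, smoothBounded_expDeriv hf hb _ _, ?_, ?_⟩
  · filter_upwards [hrep, ae_restrict_mem measurableSet_Ioi] with x h1 hx
    rw [h1, hf0 hx]
  · filter_upwards [hrep, ae_restrict_mem measurableSet_Ioi, hmem.coeFn_toLp] with x h1 hx h2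
    rw [h2, deriv_expDeriv hf, h1, ← hf0 hx, ← hf1 hx]
    simp only [ofLog, Pi.add_apply]
    push_cast
    ring

theorem summable_div_sqrt (a : ArithmeticFunction ℂ) {ε : ℝ} (hε : 0 < ε)
    (ha : Summable fun n : ℕ => ‖a n‖ * (n : ℝ) ^ ε) :
    Summable fun n : ℕ => ‖a n‖ / √(n : ℝ) := by
  refine Summable.of_nonneg_of_le (fun n => by positivity) (fun n => ?_) ha
  rcases n.eq_zero_or_pos with rfl | hn
  · simp
  · have hn' : (1 : ℝ) ≤ n := by exact_mod_cast hn
    calc ‖a n‖ / √(n : ℝ) ≤ ‖a n‖ := div_le_self (norm_nonneg _) (Real.one_le_sqrt.mpr hn')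
      _ ≤ ‖a n‖ * (n : ℝ) ^ ε :=
        le_mul_of_one_le_right (norm_nonneg _) (Real.one_le_rpow hn' hε.le)

end FourierPoisson

end

theorem mainTheorem6 (a b : ArithmeticFunction ℂ) (hab : a * b = 1)
    (ε : ℝ) (hε : 0 < ε)
    (ha : Summable fun n : ℕ => ‖a n‖ * (n : ℝ) ^ ε)
    (hb : Summable fun n : ℕ => ‖b n‖ / √(n : ℝ))
    (hgrowth : ∃ (C₀ C₁ : ℝ) (N : ℕ), ∀ x y : ℝ, |y| ≤ 1 / 2 + ε / 2 →
      LSeries (fun n => a n) (1 / 2 + (y : ℂ) + Complex.I * (x : ℂ)) ≠ 0 →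
      ‖LSeries (fun n => a n) (1 / 2 - (y : ℂ) + Complex.I * (x : ℂ)) /
        LSeries (fun n => a n) (1 / 2 + (y : ℂ) + Complex.I * (x : ℂ))‖ ≤ C₀ + C₁ * |x| ^ N)
    (f : FourierPoisson.L2) (hf : f ∈ FourierPoisson.S0) :
    ∃ (hBf : f ∈ FourierPoisson.B.domain)
      (hBg : FourierPoisson.fourierPoisson a b f ∈ FourierPoisson.B.domain),
      FourierPoisson.fourierPoisson a b (FourierPoisson.B ⟨f, hBf⟩) +
        FourierPoisson.B ⟨FourierPoisson.fourierPoisson a b f, hBg⟩ = 0 := by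
  obtain ⟨φ, v, hφ, hu, hv⟩ := FourierPoisson.exists_ofLog_of_mem_S0 hf
  obtain ⟨ψ, hψ, hg, hg'⟩ := FourierPoisson.exists_fourierPoisson_ofLog
    (FourierPoisson.summable_div_sqrt a hε ha) hb hφ hu hv
  obtain ⟨hBf, hf_eq⟩ := FourierPoisson.exists_B_eq hφ.smooth hu hv
  obtain ⟨hBg, hg_eq⟩ := FourierPoisson.exists_B_eq hψ hg hg'
  refine ⟨hBf, hBg, ?_⟩
  -- Here `B` sends f to i v and 𝓕(a)f to -i 𝓕(a)v; complex linearity of 𝓕(a) gives the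
  -- cancellation.
  rw [hf_eq, hg_eq, map_smul, smul_neg, add_neg_cancel]
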